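/- Identify three-qubit matrices with complex $8\times 8$ matrices, the indices $000,001,\dots,111$ being in lexicographic order. Call a matrix $\varrho$ a *separable three-qubit state* if it is a convex combination of (not necessarily normalized) pure product states $\xi\xi^*$, $\xi=x\otimes y\otimes z$ with $x,y,z\in\mathbb C^2$. For $a,b\in\mathbb R^4$ and $c\in\mathbb C^4$ let $X(a,b,c)$ be the $8\times 8$ matrix with diagonal $(a_1,a_2,a_3,a_4,b_4,b_3,b_2,b_1)$, with anti-diagonal entries, read from the top row to the bottom row, $c_1,c_2,c_3,c_4,\bar c_4,\bar c_3,\bar c_2,\bar c_1$, and with all other entries zero. The *X-part* of $\varrho$ is obtained from $\varrho$ by replacing all entries off the diagonal and off the anti-diagonal by $0$. Let $\varrho$ be a separable three-qubit state with X-part $X(a,b,c)$, and put $$\Delta_\varrho=\min\left\{\sqrt{a_1b_1},\ \sqrt{a_2b_2},\ \sqrt{a_3b_3},\ \sqrt{a_4b_4},\ \sqrt[4]{a_1b_2b_3a_4},\ \sqrt[4]{b_1a_2a_3b_4}\right\}.$$ Write $c_k=|c_k|e^{\mathrm i\theta_k}$ with $\theta_k\in\mathbb R$ (arbitrary if $c_k=0$),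 and let $\phi_c\in\mathbb R$ be any representative of the phase difference $(\theta_1+\theta_4)-(\theta_2+\theta_3)$ modulo $2\pi$. Let $\{i_1,i_2\}\cup\{i_3,i_4\}=\{1,2,3,4\}$ be a partition of the indices into two pairs. Suppose that a (non-degenerate) triangle in the Euclidean plane has two sides of lengths $|c_{i_1}|+|c_{i_2}|$ and $|c_{i_3}|+|c_{i_4}|$ with included angle $|\phi_c/2|$, and that this triangle is acute. Then $$\Delta_\varrho\ge R,$$ where $R$ is the radius of the circumscribed circle of the triangle. -/

import Mathlib

namespace ThreeQubit

/-- The product vector `x ⊗ y ⊗ z ∈ ℂ² ⊗ ℂ² ⊗ ℂ² = ℂ⁸`, in the lexicographic order of indices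
`000, 001, 010, 011, 100, 101, 110, 111`. -/
def productVector (x y z : Fin 2 → ℂ) : Fin 8 → ℂ :=
  ![x 0 * y 0 * z 0, x 0 * y 0 * z 1, x 0 * y 1 * z 0, x 0 * y 1 * z 1,
    x 1 * y 0 * z 0, x 1 * y 0 * z 1, x 1 * y 1 * z 0, x 1 * y 1 * z 1]

/-- The (not necessarily normalized) pure product states: the matrices `ξ ξ*` with
`ξ = x ⊗ y ⊗ z`. -/
def pureProductStates : Set (Matrix (Fin 8) (Fin 8) ℂ) :=
  {ρ | ∃ x y z : Fin 2 → ℂ,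
    ρ = Matrix.vecMulVec (productVector x y z) (star (productVector x y z))}

/-- A three-qubit state is separable if it is a convex combination of pure product states.
States are not required to have trace one, so that the separable matrices form a convex cone;
it contains all convex combinations of pure product states of trace one. -/
def IsSeparable (ρ : Matrix (Fin 8) (Fin 8) ℂ) : Prop :=
  ρ ∈ convexHull ℝ pureProductStates

/-- The X-part of an `8 × 8` matrix: all entries off the diagonal and off the anti-diagonal are
replaced by zero. -/
def xPart (ρ : Matrix (Fin 8) (Fin 8) ℂ) : Matrix (Fin 8) (Fin 8) ℂ :=
  Matrix.of fun i j => if i = j ∨ j = Fin.rev i then ρ i j else 0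

/-- The self-adjoint X-shaped matrix `X(a, b, c)`; the entries `a₁, …, a₄` are written
`a 0, …, a 3`, and similarly for `b` and `c`. -/
def xMatrix (a b : Fin 4 → ℝ) (c : Fin 4 → ℂ) : Matrix (Fin 8) (Fin 8) ℂ :=
  !![(a 0 : ℂ), 0, 0, 0, 0, 0, 0, c 0;
     0, (a 1 : ℂ), 0, 0, 0, 0, c 1, 0;
     0, 0, (a 2 : ℂ), 0, 0, c 2, 0, 0;
     0, 0, 0, (a 3 : ℂ), c 3, 0, 0, 0;
     0, 0, 0, star (c 3), (b 3 : ℂ), 0, 0, 0;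
     0, 0, star (c 2), 0, 0, (b 2 : ℂ), 0, 0;
     0, star (c 1), 0, 0, 0, 0, (b 1 : ℂ), 0;
     star (c 0), 0, 0, 0, 0, 0, 0, (b 0 : ℂ)]

/-- The number
`Δ = min {√(aᵢ bᵢ) (i = 1, 2, 3, 4), (a₁ b₂ b₃ a₄)^(1/4), (b₁ a₂ a₃ b₄)^(1/4)}`
attached to a state with X-part `X(a, b, c)`. -/
noncomputable def Delta (a b : Fin 4 → ℝ) : ℝ :=
  min (min (min (√(a 0 * b 0)) (√(a 1 * b 1))) (min (√(a 2 * b 2)) (√(a 3 * b 3))))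
    (min ((a 0 * b 1 * b 2 * a 3) ^ (1 / 4 : ℝ)) ((b 0 * a 1 * a 2 * b 3) ^ (1 / 4 : ℝ)))

/-- The real number `φ` represents the phase difference of `c`: `φ = (θ₁ + θ₄) - (θ₂ + θ₃)`
modulo `2π`, where `cᵢ = |cᵢ| exp(i θᵢ)`. If `cᵢ = 0`, then `θᵢ` is arbitrary. -/
def IsPhaseDifference (c : Fin 4 → ℂ) (φ : ℝ) : Prop :=
  ∃ θ : Fin 4 → ℝ, (∀ i, c i = (‖c i‖ : ℂ) * Complex.exp ((θ i : ℂ) * Complex.I)) ∧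
    ∃ k : ℤ, φ = (θ 0 + θ 3) - (θ 1 + θ 2) + 2 * Real.pi * (k : ℝ)

end ThreeQubit

/-! The proof is by duality. `Delta` is a minimum of geometric means, hence concave, so a
real-linear functional of the anti-diagonal that is at most `Delta` on pure product states is so on
all separable states (`IsSeparable.phaseFunctional_le_Delta`). On a product state the four entries
share a modulus `r ≤ Delta`, and their phases have phase difference zero. With weights `u, v ≥ 0` on
the two pairs, the functional aligned with the phases of `c` is then at most `2 r √(u² + v² + 2uv
cos ψ)`, `ψ = |φ/2|` (`mul_abs_cos_add_le`).

For sides `s, t` and third side `p`, take `u ∝ s - t cos ψ` and `v ∝ t - s cos ψ`, scaled so that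
the root is `1/2`. The value at `ρ` is `u s + v t = p / (2 sin ψ) = R`. Acuteness gives `u, v, cos ψ
≥ 0`. -/

namespace ThreeQubit

open Matrix

/-! ### Concavity and reduction to product states -/

/-- The geometric mean of two nonnegative concave functions is concave. -/
theorem concaveOn_sqrt_mul {E : Type*} [AddCommGroup E] [Module ℝ E] {s : Set E} {g h : E → ℝ}
    (hg : ConcaveOn ℝ s g) (hh : ConcaveOn ℝ s h) (hg0 : ∀ x ∈ s, 0 ≤ g x)
    (hh0 : ∀ x ∈ s, 0 ≤ h x) : ConcaveOn ℝ s (fun x => √(g x * h x)) := by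
  refine ⟨hg.1, fun x hx y hy p q hp hq hpq => ?_⟩
  have h1 := hg.2 hx hy hp hq hpq
  have h2 := hh.2 hx hy hp hq hpq
  simp only [smul_eq_mul] at h1 h2 ⊢
  have gx := hg0 x hx
  have gy := hg0 y hy
  have kx := hh0 x hx
  have ky := hh0 y hy
  rw [Real.sqrt_mul gx, Real.sqrt_mul gy]
  apply Real.le_sqrt_of_sq_le
  refine le_trans ?_ (mul_le_mul h1 h2 (by positivity) ((by positivity : (0 : ℝ) ≤ _).trans h1))
  have e1 := Real.sq_sqrt gx
  have e2 := Real.sq_sqrt gy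
  have e3 := Real.sq_sqrt kx
  have e4 := Real.sq_sqrt ky
  set u := √(g x)
  set v := √(g y)
  set u' := √(h x)
  set v' := √(h y)
  rw [← e1, ← e2, ← e3, ← e4]
  nlinarith [mul_nonneg (mul_nonneg hp hq) (sq_nonneg (u * v' - v * u'))]

/-- Writing the fourth root as a geometric mean of geometric means lets `concaveOn_sqrt_mul` be
iterated. -/
theorem rpow_quarter_eq_sqrt {x y z w : ℝ} (hx : 0 ≤ x) (hy : 0 ≤ y) (hz : 0 ≤ z) (hw : 0 ≤ w) :
    (x * y * z * w) ^ (1 / 4 : ℝ) = √(√(x * y) * √(z * w)) := by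
  rw [← Real.sqrt_mul (by positivity), Real.sqrt_eq_rpow, Real.sqrt_eq_rpow,
    ← Real.rpow_mul (by positivity)]
  congr 1
  · ring
  · norm_num

/-- The first half `a` of the diagonal of an `8 × 8` matrix. -/
def upperDiag (M : Matrix (Fin 8) (Fin 8) ℂ) : Fin 4 → ℝ :=
  ![(M 0 0).re, (M 1 1).re, (M 2 2).re, (M 3 3).re]

/-- The second half `b` of the diagonal of an `8 × 8` matrix, read from the bottom. -/
def lowerDiag (M : Matrix (Fin 8) (Fin 8) ℂ) : Fin 4 → ℝ :=
  ![(M 7 7).re, (M 6 6).re, (M 5 5).re, (M 4 4).re]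

/-- The upper half `c` of the anti-diagonal of an `8 × 8` matrix. -/
def antiDiag (M : Matrix (Fin 8) (Fin 8) ℂ) : Fin 4 → ℂ :=
  ![M 0 7, M 1 6, M 2 5, M 3 4]

/-- The matrices whose diagonal entries have nonnegative real parts. -/
def diagNonneg : Set (Matrix (Fin 8) (Fin 8) ℂ) := {M | ∀ k, 0 ≤ (M k k).re}

theorem convex_diagNonneg : Convex ℝ diagNonneg := by
  intro M hM N hN p q hp hq _ k
  have h1 := hM k
  have h2 := hN k
  simp only [Matrix.add_apply, Matrix.smul_apply, Complex.add_re, Complex.smul_re, smul_eq_mul]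
  positivity

theorem concaveOn_diag (k : Fin 8) :
    ConcaveOn ℝ diagNonneg (fun M : Matrix (Fin 8) (Fin 8) ℂ => (M k k).re) :=
  ⟨convex_diagNonneg, fun M _ N _ p q _ _ _ => by simp⟩

theorem concaveOn_Delta :
    ConcaveOn ℝ diagNonneg (fun M => Delta (upperDiag M) (lowerDiag M)) := by
  have two (j k : Fin 8) :
      ConcaveOn ℝ diagNonneg (fun M : Matrix (Fin 8) (Fin 8) ℂ => √((M j j).re * (M k k).re)) :=
    concaveOn_sqrt_mul (concaveOn_diag j) (concaveOn_diag k) (fun M hM => hM j) (fun M hM => hM k)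
  have four (i j k l : Fin 8) : ConcaveOn ℝ diagNonneg (fun M : Matrix (Fin 8) (Fin 8) ℂ =>
      ((M i i).re * (M j j).re * (M k k).re * (M l l).re) ^ (1 / 4 : ℝ)) :=
    (concaveOn_sqrt_mul (two i j) (two k l) (fun _ _ => Real.sqrt_nonneg _)
      (fun _ _ => Real.sqrt_nonneg _)).congr
      (fun M hM => (rpow_quarter_eq_sqrt (hM i) (hM j) (hM k) (hM l)).symm)
  exact (((two 0 7).inf (two 1 6)).inf ((two 2 5).inf (two 3 4))).inf
    ((four 0 6 5 3).inf (four 7 1 2 4))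

/-- The real functional `M ↦ ∑ wₖ Re (exp(-i θₖ) cₖ)`, where `c` is the anti-diagonal of `M`. -/
noncomputable def phaseFunctional (w θ : Fin 4 → ℝ) (M : Matrix (Fin 8) (Fin 8) ℂ) : ℝ :=
  ∑ k, w k * (antiDiag M k * Complex.exp ((-θ k : ℝ) * Complex.I)).re

theorem convexOn_phaseFunctional (w θ : Fin 4 → ℝ) :
    ConvexOn ℝ diagNonneg (phaseFunctional w θ) := by
  refine ⟨convex_diagNonneg, fun M _ N _ p q _ _ _ => le_of_eq ?_⟩
  simp only [phaseFunctional, antiDiag, Fin.sum_univ_four, smul_eq_mul,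
    Matrix.add_apply, Matrix.smul_apply,
    cons_val, Complex.mul_re, Complex.add_re, Complex.add_im, Complex.smul_re, Complex.smul_im]
  ring

/-- If a functional `phaseFunctional w θ` is bounded by `Delta` on pure product states, it is so
on separable states. -/
theorem IsSeparable.phaseFunctional_le_Delta {w θ : Fin 4 → ℝ}
    {ρ : Matrix (Fin 8) (Fin 8) ℂ} (hρ : IsSeparable ρ)
    (h : ∀ M ∈ pureProductStates, phaseFunctional w θ M ≤ Delta (upperDiag M) (lowerDiag M)) :
    phaseFunctional w θ ρ ≤ Delta (upperDiag ρ) (lowerDiag ρ) := by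
  -- A superlevel set of a concave function is convex, so it contains the hull of the product
  -- states.
  have hc := (concaveOn_Delta.sub (convexOn_phaseFunctional w θ)).convex_ge 0
  have hdiag : pureProductStates ⊆ diagNonneg := by
    rintro _ ⟨x, y, z, rfl⟩ k
    simp only [vecMulVec_apply, Pi.star_apply, Complex.star_def, Complex.mul_conj,
      Complex.ofReal_re]
    exact Complex.normSq_nonneg _
  have hsub : pureProductStates ⊆ _ := fun M hM =>
    Set.mem_sep (hdiag hM) (sub_nonneg.2 (h M hM))
  exact sub_nonneg.1 (convexHull_min hsub hc hρ).2

/-! ### Anti-diagonals of product states -/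

/-- `Delta` of a pure product state dominates the common modulus of its anti-diagonal entries. -/
theorem le_Delta_productVector (x y z : Fin 2 → ℂ) :
    ‖x 0‖ * ‖x 1‖ * (‖y 0‖ * ‖y 1‖) * (‖z 0‖ * ‖z 1‖) ≤
      Delta (upperDiag (vecMulVec (productVector x y z) (star (productVector x y z))))
        (lowerDiag (vecMulVec (productVector x y z) (star (productVector x y z)))) := by
  have quarter {r t : ℝ} (hr : 0 ≤ r) (h : t = r ^ 4) : r ≤ t ^ (1 / 4 : ℝ) := by
    rw [h, ← Real.rpow_natCast, ← Real.rpow_mul hr]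
    norm_num
  simp only [Delta, upperDiag, lowerDiag, cons_val, vecMulVec_apply, Pi.star_apply,
    Complex.star_def, Complex.mul_conj, Complex.ofReal_re, productVector,
    Complex.normSq_eq_norm_sq, norm_mul]
  refine le_min (le_min (le_min ?_ ?_) (le_min ?_ ?_)) (le_min ?_ ?_)
  iterate 4 exact Real.le_sqrt_of_sq_le (le_of_eq (by ring))
  iterate 2 exact quarter (by positivity) (by ring)

theorem re_polar_mul_exp (r s t : ℝ) :
    ((r : ℂ) * Complex.exp (s * Complex.I) * Complex.exp ((t : ℝ) * Complex.I)).re =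
      r * Real.cos (s + t) := by
  rw [mul_assoc, ← Complex.exp_add, ← add_mul, ← Complex.ofReal_add, Complex.re_ofReal_mul,
    Complex.exp_ofReal_mul_I_re]

/-- The anti-diagonal entries of a pure product state have a common modulus, and their phases
are `A + B + C`, `A + B - C`, `A - B + C`, `A - B - C`. -/
theorem antiDiag_productVector (x y z : Fin 2 → ℂ) :
    ∃ A B C : ℝ, ∀ k,
      antiDiag (vecMulVec (productVector x y z) (star (productVector x y z))) k =
      ((‖x 0‖ * ‖x 1‖ * (‖y 0‖ * ‖y 1‖) * (‖z 0‖ * ‖z 1‖) : ℝ) : ℂ) * Complex.exp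
        (((![A + B + C, A + B - C, A - B + C, A - B - C] : Fin 4 → ℝ) k : ℝ) * Complex.I) := by
  have polar (u : Fin 2 → ℂ) : ∃ A : ℝ,
      u 0 * star (u 1) = (‖u 0‖ * ‖u 1‖ : ℝ) * Complex.exp (A * Complex.I) ∧
      u 1 * star (u 0) = (‖u 0‖ * ‖u 1‖ : ℝ) * Complex.exp (-(A * Complex.I)) := by
    have h1 : u 0 * star (u 1) =
        (‖u 0‖ * ‖u 1‖ : ℝ) * Complex.exp ((u 0 * star (u 1)).arg * Complex.I) := by
      conv_lhs => rw [← Complex.norm_mul_exp_arg_mul_I (u 0 * star (u 1))]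
      rw [norm_mul, norm_star]
    refine ⟨(u 0 * star (u 1)).arg, h1, ?_⟩
    have h2 := congrArg star h1
    rw [star_mul', star_star, mul_comm] at h2
    rw [h2]
    simp [← Complex.exp_conj]
  obtain ⟨A, hA, -⟩ := polar x
  obtain ⟨B, hB, hB'⟩ := polar y
  obtain ⟨C, hC, hC'⟩ := polar z
  refine ⟨A, B, C, fun k => ?_⟩
  have split (a b c a' b' c' : ℂ) :
      a * b * c * star (a' * b' * c') = a * star a' * (b * star b') * (c * star c') := by
    simp only [star_mul']; ring
  fin_cases k <;>
  · simp only [antiDiag, vecMulVec_apply, Pi.star_apply, productVector, cons_val, split, hA, hB,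
      hC, hB', hC', Fin.zero_eta, Fin.mk_one, Fin.reduceFinMk]
    push_cast
    simp only [add_mul, sub_mul, Complex.exp_add, Complex.exp_sub, Complex.exp_neg, div_eq_mul_inv]
    ring

/-! ### Trigonometric bounds on product states -/

theorem cos_add_cos_le (x y : ℝ) : Real.cos x + Real.cos y ≤ 2 * |Real.cos ((x + y) / 2)| := by
  rw [Real.cos_add_cos]
  have h1 := Real.abs_cos_le_one ((x - y) / 2)
  have h2 := le_abs_self (Real.cos ((x + y) / 2) * Real.cos ((x - y) / 2))
  rw [abs_mul] at h2
  nlinarith [abs_nonneg (Real.cos ((x + y) / 2))]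

/-- Cauchy–Schwarz for the quadratic form `p² + q² - 2 p q cos ψ` and its dual. -/
theorem mul_abs_cos_add_le {ψ P Q n : ℝ} (hψ : 0 < Real.sin ψ) (hn : 0 ≤ n)
    (hPQ : P ^ 2 + Q ^ 2 + 2 * P * Q * Real.cos ψ = n ^ 2)
    (x y : ℝ) (hcos : |Real.cos (x - y)| = Real.cos ψ) :
    P * |Real.cos x| + Q * |Real.cos y| ≤ n := by
  have hs : Real.sin (x - y) ^ 2 = Real.sin ψ ^ 2 := by
    rw [Real.sin_sq, Real.sin_sq, ← hcos, sq_abs]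
  -- This identity puts `(|cos x|, |cos y|)` inside the ellipse `p² + q² - 2pq cos ψ ≤ sin² ψ`.
  have hid : Real.cos x ^ 2 + Real.cos y ^ 2 - 2 * (Real.cos x * Real.cos y * Real.cos (x - y)) =
      Real.sin (x - y) ^ 2 := by
    rw [Real.cos_sub, Real.sin_sub]
    linear_combination (-Real.cos x ^ 2) * Real.sin_sq_add_cos_sq y
      - Real.cos y ^ 2 * Real.sin_sq_add_cos_sq x
  have habs : Real.cos x * Real.cos y * Real.cos (x - y) ≤
      |Real.cos x| * |Real.cos y| * Real.cos ψ := by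
    rw [← hcos, ← abs_mul, ← abs_mul]
    exact le_abs_self _
  have hle : |Real.cos x| ^ 2 + |Real.cos y| ^ 2 - 2 * (|Real.cos x| * |Real.cos y| * Real.cos ψ) ≤
      Real.sin ψ ^ 2 := by
    rw [sq_abs, sq_abs, ← hs, ← hid]; linarith
  set p := |Real.cos x|
  set q := |Real.cos y|
  have hsc := Real.sin_sq_add_cos_sq ψ
  have key : (P * p + Q * q) ^ 2 * Real.sin ψ ^ 2 ≤
      n ^ 2 * (p ^ 2 + q ^ 2 - 2 * (p * q * Real.cos ψ)) := by
    rw [← hPQ, eq_sub_of_add_eq hsc]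
    nlinarith [sq_nonneg (P * q - Q * p + (Q * q - P * p) * Real.cos ψ)]
  have key2 : (P * p + Q * q) ^ 2 * Real.sin ψ ^ 2 ≤ n ^ 2 * Real.sin ψ ^ 2 :=
    key.trans (mul_le_mul_of_nonneg_left hle (sq_nonneg n))
  exact abs_le_of_sq_le_sq' (le_of_mul_le_mul_right key2 (by positivity)) hn |>.2

/-- The weights with value `u` on `{i 0, i 1}` and `v` on `{i 2, i 3}`. -/
def pairWeight (i : Equiv.Perm (Fin 4)) (u v : ℝ) : Fin 4 → ℝ := ![u, u, v, v] ∘ i.symm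

theorem sum_pairWeight_mul (i : Equiv.Perm (Fin 4)) (u v : ℝ) (g : Fin 4 → ℝ) :
    ∑ k, pairWeight i u v k * g k = u * (g (i 0) + g (i 1)) + v * (g (i 2) + g (i 3)) := by
  rw [← Equiv.sum_comp i]
  simp only [pairWeight, Function.comp_apply, Equiv.symm_apply_apply, Fin.sum_univ_four, cons_val]
  ring

/-- The norm `1/2` of the weights cancels the factor `2` from `cos_add_cos_le`. -/
theorem phaseFunctional_le_Delta_of_mem_pureProductStates {i : Equiv.Perm (Fin 4)} {u v ψ φ : ℝ}
    {θ : Fin 4 → ℝ} (hu : 0 ≤ u) (hv : 0 ≤ v) (hsin : 0 < Real.sin ψ) (hcos : 0 ≤ Real.cos ψ)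
    (huv : u ^ 2 + v ^ 2 + 2 * u * v * Real.cos ψ = (1 / 2) ^ 2) (hψ : ψ = |φ / 2|)
    (hφ : ∃ k : ℤ, φ = (θ 0 + θ 3) - (θ 1 + θ 2) + 2 * Real.pi * (k : ℝ))
    {M : Matrix (Fin 8) (Fin 8) ℂ} (hM : M ∈ pureProductStates) :
    phaseFunctional (pairWeight i u v) θ M ≤ Delta (upperDiag M) (lowerDiag M) := by
  obtain ⟨x, y, z, rfl⟩ := hM
  refine le_trans ?_ (le_Delta_productVector x y z)
  obtain ⟨A, B, C, h⟩ := antiDiag_productVector x y z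
  obtain ⟨m, hm⟩ := hφ
  set r := ‖x 0‖ * ‖x 1‖ * (‖y 0‖ * ‖y 1‖) * (‖z 0‖ * ‖z 1‖)
  have hr : 0 ≤ r := by positivity
  -- Flipping two signs leaves the cosines unchanged and makes `A, B, C` cancel in the sum of all
  -- four, which is symmetric, so every pairing works alike.
  set t : Fin 4 → ℝ := ![A + B + C - θ 0, -(A + B - C - θ 1), -(A - B + C - θ 2), A - B - C - θ 3]
    with ht
  have hcosd (k : Fin 4) : (antiDiag (vecMulVec (productVector x y z) (star (productVector x y z))) k
      * Complex.exp ((-θ k : ℝ) * Complex.I)).re = r * Real.cos (t k) := by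
    rw [h, re_polar_mul_exp]
    fin_cases k
    · rfl
    · simp only [ht, cons_val, Fin.mk_one, Real.cos_neg]; rfl
    · simp only [ht, cons_val, Fin.reduceFinMk, Real.cos_neg]; rfl
    · rfl
  have hsum : t (i 0) + t (i 1) + (t (i 2) + t (i 3)) = 2 * Real.pi * m - φ := by
    have := Equiv.sum_comp i t
    rw [Fin.sum_univ_four, Fin.sum_univ_four] at this
    rw [← add_assoc, this, hm]
    simp only [ht, cons_val]
    ring
  have hd : |Real.cos ((t (i 0) + t (i 1)) / 2 - -((t (i 2) + t (i 3)) / 2))| = Real.cos ψ := by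
    -- Halving turns the ambiguity `2πm` into `mπ`, which only changes the sign of the cosine.
    have e : (t (i 0) + t (i 1)) / 2 - -((t (i 2) + t (i 3)) / 2) = m * Real.pi - φ / 2 := by
      linarith
    rw [e, Real.cos_int_mul_pi_sub, abs_mul, ← Real.cos_abs (φ / 2), ← hψ, abs_of_nonneg hcos]
    simp
  have hmain := mul_abs_cos_add_le hsin (by norm_num) huv _ _ hd
  rw [Real.cos_neg] at hmain
  rw [phaseFunctional]
  simp only [hcosd]
  rw [sum_pairWeight_mul]
  have h1 := mul_le_mul_of_nonneg_left (cos_add_cos_le (t (i 0)) (t (i 1))) hu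
  have h2 := mul_le_mul_of_nonneg_left (cos_add_cos_le (t (i 2)) (t (i 3))) hv
  nlinarith

theorem diag_antiDiag_of_xPart_eq {ρ : Matrix (Fin 8) (Fin 8) ℂ} {a b : Fin 4 → ℝ} {c : Fin 4 → ℂ}
    (hX : xPart ρ = xMatrix a b c) : upperDiag ρ = a ∧ lowerDiag ρ = b ∧ antiDiag ρ = c := by
  have e (j k : Fin 8) : (if j = k ∨ k = Fin.rev j then ρ j k else 0) = xMatrix a b c j k := by
    rw [← hX]; rfl
  have d (k : Fin 8) : ρ k k = xMatrix a b c k k := by rw [← e, if_pos (Or.inl rfl)]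
  have f (k : Fin 8) : ρ k (Fin.rev k) = xMatrix a b c k (Fin.rev k) := by
    rw [← e, if_pos (Or.inr rfl)]
  refine ⟨?_, ?_, ?_⟩ <;> funext k <;> fin_cases k
  · exact congrArg Complex.re (d 0)
  · exact congrArg Complex.re (d 1)
  · exact congrArg Complex.re (d 2)
  · exact congrArg Complex.re (d 3)
  · exact congrArg Complex.re (d 7)
  · exact congrArg Complex.re (d 6)
  · exact congrArg Complex.re (d 5)
  · exact congrArg Complex.re (d 4)
  · exact f 0
  · exact f 1
  · exact f 2
  · exact f 3

/-! ### The triangle and the choice of weights -/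

/-- If the angle at `q` of a triangle `p q r` is acute, the side `p q` is at least as long as the
projection of the side `p r` to its line. -/
theorem dist_mul_cos_angle_le_dist {V P : Type*} [NormedAddCommGroup V] [InnerProductSpace ℝ V]
    [MetricSpace P] [NormedAddTorsor V P] {p q r : P} (hpq : p ≠ q)
    (h : EuclideanGeometry.angle p q r < Real.pi / 2) :
    dist p r * Real.cos (EuclideanGeometry.angle q p r) ≤ dist p q := by
  have h1 := EuclideanGeometry.law_cos p q r
  have h2 := EuclideanGeometry.law_cos q p r
  have hc : 0 ≤ Real.cos (EuclideanGeometry.angle p q r) :=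
    Real.cos_nonneg_of_neg_pi_div_two_le_of_le
      (by linarith [EuclideanGeometry.angle_nonneg p q r, Real.pi_pos]) h.le
  have hpos := dist_pos.2 hpq
  rw [dist_comm q p, dist_comm r p] at h2
  rw [dist_comm r q] at h1
  have h3 : 0 ≤ dist p q * dist q r * Real.cos (EuclideanGeometry.angle p q r) := by positivity
  refine le_of_mul_le_mul_left ?_ hpos
  nlinarith

end ThreeQubit

theorem proposition5p3
    (ρ : Matrix (Fin 8) (Fin 8) ℂ) (hρ : ThreeQubit.IsSeparable ρ)
    (a b : Fin 4 → ℝ) (c : Fin 4 → ℂ)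
    (hX : ThreeQubit.xPart ρ = ThreeQubit.xMatrix a b c)
    (φ : ℝ) (hφ : ThreeQubit.IsPhaseDifference c φ)
    -- the partition `{i 0, i 1} ∪ {i 2, i 3}` of the four indices
    (i : Equiv.Perm (Fin 4))
    -- the triangle with the two given sides at the vertex `0` and the given angle between them
    (T : Affine.Triangle ℝ (EuclideanSpace ℝ (Fin 2)))
    (hside₁ : dist (T.points 0) (T.points 1) = ‖c (i 0)‖ + ‖c (i 1)‖)
    (hside₂ : dist (T.points 0) (T.points 2) = ‖c (i 2)‖ + ‖c (i 3)‖)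
    (hangle : EuclideanGeometry.angle (T.points 1) (T.points 0) (T.points 2) = |φ / 2|)
    (hacute : T.AcuteAngled) :
    T.circumradius ≤ ThreeQubit.Delta a b := by
  obtain ⟨θ, hθ, hk⟩ := hφ
  obtain ⟨rfl, rfl, rfl⟩ := ThreeQubit.diag_antiDiag_of_xPart_eq hX
  have hne {j k : Fin 3} (h : j ≠ k) : T.points j ≠ T.points k := T.independent.injective.ne h
  have hR := EuclideanGeometry.law_cos (T.points 1) (T.points 0) (T.points 2)
  have hsine := T.dist_div_sin_angle_eq_two_mul_circumradius (i₁ := 1) (i₂ := 0) (i₃ := 2)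
    (by decide) (by decide) (by decide)
  have hA := hacute 1 0 2 (by decide) (by decide) (by decide)
  have hu := ThreeQubit.dist_mul_cos_angle_le_dist (hne (show (0 : Fin 3) ≠ 1 by decide))
    (hacute 0 1 2 (by decide) (by decide) (by decide))
  have hv := ThreeQubit.dist_mul_cos_angle_le_dist (hne (show (0 : Fin 3) ≠ 2 by decide))
    (hacute 0 2 1 (by decide) (by decide) (by decide))
  rw [EuclideanGeometry.angle_comm (T.points 2)] at hv
  have hp : 0 < dist (T.points 1) (T.points 2) := dist_pos.2 (hne (by decide))
  have hcos : 0 ≤ Real.cos (EuclideanGeometry.angle (T.points 1) (T.points 0) (T.points 2)) :=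
    Real.cos_nonneg_of_neg_pi_div_two_le_of_le
      (by linarith [EuclideanGeometry.angle_nonneg (T.points 1) (T.points 0) (T.points 2),
        Real.pi_pos]) hA.le
  have hRpos : 0 < T.circumradius := T.circumradius_pos
  rw [dist_comm (T.points 1) (T.points 0), dist_comm (T.points 2) (T.points 0)] at hR
  set ψ := EuclideanGeometry.angle (T.points 1) (T.points 0) (T.points 2)
  set R := T.circumradius
  set p := dist (T.points 1) (T.points 2)
  set s := dist (T.points 0) (T.points 1)
  set t := dist (T.points 0) (T.points 2)
  have hsin : 0 < Real.sin ψ := by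
    by_contra! h
    have : p / Real.sin ψ ≤ 0 := div_nonpos_of_nonneg_of_nonpos hp.le h
    linarith
  have hpR : p = 2 * R * Real.sin ψ := (div_eq_iff hsin.ne').1 hsine
  have hsc := Real.sin_sq_add_cos_sq ψ
  -- By the law of sines `p² = D R`; dividing the weights by `D` gives them squared norm `p² sin² ψ
  -- / D² = 1/4`.
  set D := 4 * R * Real.sin ψ ^ 2 with hD
  have hDpos : 0 < D := by positivity
  have hq : s ^ 2 + t ^ 2 - 2 * s * t * Real.cos ψ = D * R := by
    rw [hD]
    linear_combination (p + 2 * R * Real.sin ψ) * hpR - hR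
  have huv : ((s - t * Real.cos ψ) / D) ^ 2 + ((t - s * Real.cos ψ) / D) ^ 2 +
      2 * ((s - t * Real.cos ψ) / D) * ((t - s * Real.cos ψ) / D) * Real.cos ψ = (1 / 2) ^ 2 := by
    field_simp
    have hD2 : D ^ 2 = 4 * (D * R) * Real.sin ψ ^ 2 := by rw [hD]; ring
    rw [hD2, ← hq, eq_sub_of_add_eq hsc]
    ring
  have hle := hρ.phaseFunctional_le_Delta (w := ThreeQubit.pairWeight i _ _) (θ := θ) (fun M hM =>
    ThreeQubit.phaseFunctional_le_Delta_of_mem_pureProductStates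
      (div_nonneg (sub_nonneg.2 hu) hDpos.le) (div_nonneg (sub_nonneg.2 hv) hDpos.le)
      hsin hcos huv hangle hk hM)
  refine le_trans (le_of_eq ?_) hle
  have hval (k : Fin 4) : (ThreeQubit.antiDiag ρ k *
      Complex.exp ((-θ k : ℝ) * Complex.I)).re = ‖ThreeQubit.antiDiag ρ k‖ := by
    conv_lhs => rw [hθ k]
    rw [ThreeQubit.re_polar_mul_exp, add_neg_cancel, Real.cos_zero, mul_one]
  rw [ThreeQubit.phaseFunctional]
  simp only [hval]
  rw [ThreeQubit.sum_pairWeight_mul, ← hside₁, ← hside₂]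
  field_simp
  linarith
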